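/- **Definitions.** A *diagram* is a finite set $N$ with a symmetric matrix $B\in\mathbb Z^{N\times N}$ whose diagonal entries are even; it is a *graph* if all $B_{ij}\ge 0$ and all $B_{ii}=0$. Diagrams are considered up to relabelling of $N$. The Galois conjugates of a Puiseux polynomial $q=\sum_k a_kz^k$ (finitely many exponents $k\in\mathbb Q_{>0}$) are $\sum_k e^{2\pi i nk}a_kz^k$, $n\in\mathbb Z$; the set $\langle q\rangle$ of these is a *Stokes circle*. The *ramification order* $r$ of $q$ is the least integer $r\ge1$ such that $q\in\mathbb C[z^{1/r}]$, and the slope of $q$ is its largest exponent ($0$ if $q=0$). An algebraic connection on the affine line is an algebraic vector bundle with a connection $\nabla$, in a global frame $\nabla=d-A\,dz$ with $A$ a square matrix over $\mathbb C[z]$. Its *irregular class* at infinity is the finite multiset $\Theta=\sum n_iI_i$ of Stokes circles such that in a Turrittin–Levelt normal form $w'=(Q'+\Lambda/z)w$ of $v'=Av$ over some $\mathbb C((z^{-1/r}))$ (with $Q$ a diagonal matrix of Puiseux polynomials as above and $\Lambda$ a constant matrix commuting with $Q$) each $q$ occurs in the diagonal of $Q$ exactly as often as $\langle q\rangle$ occurs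 in $\Theta$. $\Theta$ is *untwisted* if all its circles have ramification order $1$. The *core diagram* $\Gamma_c(\Theta)$ has as vertices the distinct circles of $\Theta$, and the following multiplicities. * If $I=\langle q\rangle$ has ramification order $r$ and exponents $m_0/r>\dots>m_p/r$, put $g_j=\gcd(r,m_0,\dots,m_j)$ and $g_{-1}=r$; then $B_{I,I}=\sum_{j=0}^p m_j(g_{j-1}-g_j)-r^2+1$. * Let $I=\langle q\rangle\ne J=\langle q'\rangle$ have ramification orders $r,r'$. Let $c$ be the least element of $\frac1{\mathrm{lcm}(r,r')}\mathbb Z_{>0}$ such that the parts $q_c,q'_c$ of $q,q'$ with exponents $\ge c$ satisfy $\langle q_c\rangle=\langle q'_c\rangle$. Exchange $I$ and $J$ if necessary so that the slope $s_d/r$ of $q-q_c$ is at least that of $q'-q'_c$. Write the exponents of $q_c$ as $m_0/r=m_0'/r'>\dots>m_t/r=m_t'/r'$, and put $g'_j=\gcd(r',m'_0,\dots,m'_j)$ and $g'_{-1}=r'$ (with $t=-1$ if $q_c=0$). Then $B_{I,J}=B_{J,I}=\sum_{j=0}^t m_j(g'_{j-1}-g'_j)+s_dg'_t-rr'$. A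 *nonabelian Hodge graph* is a graph of the form $\Gamma_c(\Theta)$ with $\Theta$ the irregular class of an algebraic connection on the affine line. A *fission graph* is a diagram of the form $\Gamma_c(\Theta)$ with $\Theta$ the untwisted irregular class of such a connection. **Proposition.** There exist nonabelian Hodge graphs that are not fission graphs. Explicitly, for $a,b,c\in\mathbb C$ let $\nabla_{a,b,c}=d-A\,dz$ be the rank $6$ connection whose matrix $A$ is block diagonal with blocks $$\begin{pmatrix} a z^2\end{pmatrix},\qquad \begin{pmatrix}0&1&0\\0&0&1\\ bz&0&0\end{pmatrix},\qquad \begin{pmatrix}0&1\\ cz&0\end{pmatrix}.$$ Then: 1. $\nabla_{1,1,1}$ has irregular class $\Theta'=\langle \tfrac13z^3\rangle+\langle\tfrac34 z^{4/3}\rangle+\langle\tfrac23z^{3/2}\rangle$, and $\nabla_{3,\,64/27,\,9/4}$ has irregular class $\Theta=\langle z^3\rangle+\langle z^{4/3}\rangle+\langle z^{3/2}\rangle$. 2. The circles $I=\langle z^3\rangle$, $J=\langle z^{4/3}\rangle$, $K=\langle z^{3/2}\rangle$ are pairwise distinct, and $B_{I,I}=B_{J,J}=B_{K,K}=0$, $B_{I,J}=6$,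 $B_{J,K}=3$, $B_{K,I}=4$. 3. The core diagrams of $\Theta$ and of $\Theta'$ are both the loopless triangle with edge multiplicities $3,4,6$. 4. This triangle violates the ultrametric condition (for pairwise distinct vertices $i,j,k$, if $B_{ij}\le B_{ik}\le B_{jk}$ then $B_{ik}=B_{jk}$). It is a nonabelian Hodge graph and is not a fission graph. -/

import Mathlib

open scoped Polynomial

noncomputable section

namespace NAHodge

/-! ### Diagrams and graphs -/

/-- A diagram `(N, B)`: a finite set `N` with a symmetric integer matrix `B` indexed by `N` whose
diagonal entries are even. For `i ≠ j`, `B i j` is the number of edges between `i` and `j`, and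
`B i i / 2` is the number of loops at `i` (all of these may be negative). -/
structure Diagram where
  N : Type
  finite_N : Finite N
  B : N → N → ℤ
  symm : ∀ i j, B i j = B j i
  even_loop : ∀ i, Even (B i i)

/-- A graph is a diagram without loops and without negative edges. -/
def Diagram.IsGraph (Γ : Diagram) : Prop :=
  (∀ i j, 0 ≤ Γ.B i j) ∧ ∀ i, Γ.B i i = 0

/-- The ultrametric condition on edge multiplicities: in every triangle, the two largest edge
multiplicities are equal. -/
def Diagram.IsUltrametric (Γ : Diagram) : Prop :=
  ∀ i j k : Γ.N, i ≠ j → i ≠ k → j ≠ k →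
    Γ.B i j ≤ Γ.B i k → Γ.B i k ≤ Γ.B j k → Γ.B i k = Γ.B j k

/-! ### Exponential factors and Stokes circles -/

/-- Positive rational numbers: the possible exponents. -/
abbrev Exponent : Type := {k : ℚ // 0 < k}

/-- An exponential factor at infinity: a Puiseux polynomial `q = ∑ₖ aₖ z ^ k` in `z` with finitely
many exponents `k`, all of them positive rational numbers, and complex coefficients. -/
abbrev ExpFactor : Type := Exponent →₀ ℂ

/-- Two exponential factors are Galois conjugate if one is obtained from the other by going `n`
times around infinity, which multiplies `z ^ k` by `exp (2 π i n k)`. -/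
def GaloisConj (q q' : ExpFactor) : Prop :=
  ∃ n : ℤ, ∀ k : Exponent,
    q' k = Complex.exp (2 * Real.pi * Complex.I * n * ((k : ℚ) : ℂ)) * q k

theorem GaloisConj.refl (q : ExpFactor) : GaloisConj q q := ⟨0, fun k => by simp⟩

theorem GaloisConj.symm {q q' : ExpFactor} (h : GaloisConj q q') : GaloisConj q' q := by
  obtain ⟨n, hn⟩ := h
  refine ⟨-n, fun k => ?_⟩
  rw [hn k, ← mul_assoc, ← Complex.exp_add]
  have : 2 * (Real.pi : ℂ) * Complex.I * ((-n : ℤ) : ℂ) * ((k : ℚ) : ℂ)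
      + 2 * Real.pi * Complex.I * n * ((k : ℚ) : ℂ) = 0 := by push_cast; ring
  rw [this, Complex.exp_zero, one_mul]

theorem GaloisConj.trans {q q' q'' : ExpFactor} (h : GaloisConj q q') (h' : GaloisConj q' q'') :
    GaloisConj q q'' := by
  obtain ⟨n, hn⟩ := h
  obtain ⟨m, hm⟩ := h'
  refine ⟨m + n, fun k => ?_⟩
  rw [hm k, hn k, ← mul_assoc, ← Complex.exp_add]
  congr 2
  push_cast
  ring

instance galoisSetoid : Setoid ExpFactor :=
  ⟨GaloisConj, GaloisConj.refl, GaloisConj.symm, GaloisConj.trans⟩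

/-- A Stokes circle `⟨q⟩`: the Galois orbit of an exponential factor `q`. -/
def StokesCircle : Type := Quotient galoisSetoid

/-- The Stokes circle `⟨q⟩` of an exponential factor `q`. -/
def circ (q : ExpFactor) : StokesCircle := Quotient.mk galoisSetoid q

/-- The monomial exponential factor `a z ^ k`. -/
def mono (a : ℂ) (k : ℚ) (hk : 0 < k) : ExpFactor := Finsupp.single ⟨k, hk⟩ a

theorem GaloisConj.support_eq {q q' : ExpFactor} (h : GaloisConj q q') :
    q'.support = q.support := by
  obtain ⟨n, hn⟩ := h
  ext k
  simp [hn k, Complex.exp_ne_zero]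

/-- The ramification order of `q`: the smallest `r ≥ 1` such that `q` is a polynomial in
`z ^ (1 / r)`, that is, the least common multiple of the denominators of its exponents. -/
def ram (q : ExpFactor) : ℕ := q.support.lcm fun k => (k : ℚ).den

theorem ram_isLeast (q : ExpFactor) :
    IsLeast {r : ℕ | 1 ≤ r ∧ ∀ k ∈ q.support, ∃ j : ℕ, (k : ℚ) = (j : ℚ) / (r : ℚ)} (ram q) := by
  have key : ∀ r : ℕ, 1 ≤ r → ∀ k : Exponent,
      (∃ j : ℕ, (k : ℚ) = (j : ℚ) / (r : ℚ)) ↔ (k : ℚ).den ∣ r := by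
    intro r hr k
    have hr0 : (r : ℚ) ≠ 0 := by positivity
    constructor
    · rintro ⟨j, hj⟩
      have := Rat.den_dvd (j : ℤ) (r : ℤ)
      rw [Rat.divInt_eq_div] at this
      push_cast at this
      rw [← hj] at this
      exact_mod_cast this
    · rintro ⟨c, hc⟩
      have hd : ((k : ℚ).den : ℚ) ≠ 0 := by exact_mod_cast (k : ℚ).den_nz
      have hc0 : (c : ℚ) ≠ 0 := by
        rintro h
        apply hr0
        rw [hc]; push_cast; rw [h, mul_zero]
      have hn : 0 ≤ (k : ℚ).num := Rat.num_nonneg.2 k.2.le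
      refine ⟨(k : ℚ).num.toNat * c, ?_⟩
      have h1 : (((k : ℚ).num.toNat : ℕ) : ℚ) = ((k : ℚ).num : ℚ) := by
        exact_mod_cast congrArg (Int.cast : ℤ → ℚ) (Int.toNat_of_nonneg hn)
      rw [hc]
      push_cast
      rw [h1, mul_div_mul_right _ _ hc0, Rat.num_div_den]
  have hpos : 1 ≤ ram q := by
    rw [Nat.one_le_iff_ne_zero, ram, Ne, Finset.lcm_eq_zero_iff]
    rintro ⟨k, -, hk⟩
    exact (k : ℚ).den_nz hk
  refine ⟨⟨hpos, fun k hk => (key _ hpos k).2 (Finset.dvd_lcm hk)⟩, ?_⟩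
  rintro r ⟨hr, h⟩
  exact Nat.le_of_dvd hr (Finset.lcm_dvd fun k hk => (key r hr k).1 (h k hk))

theorem GaloisConj.ram_eq {q q' : ExpFactor} (h : GaloisConj q q') : ram q' = ram q := by
  unfold ram; rw [h.support_eq]

/-- The slope of `q`: its largest exponent (and `0` if `q = 0`). -/
def slope (q : ExpFactor) : ℚ :=
  ((q.support.sup fun k => (k : ℚ).toNNRat : NNRat) : ℚ)

/-- The numerator `r k` of the exponent `k` written with denominator `r` (it is used only when
`r k` is an integer). -/
def numer (r : ℕ) (k : ℚ) : ℕ := ⌊(r : ℚ) * k⌋₊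

/-- The greatest common divisor of `r` and of all the `r k` for `k ∈ S`. -/
def gcdOf (r : ℕ) (S : Finset Exponent) : ℕ := Nat.gcd r (S.gcd fun k => numer r k)

/-- For a set of exponents `S = {k₀ > ⋯ > kₜ}` with `kⱼ = mⱼ / r = m'ⱼ / r'`, the sum
`∑ⱼ mⱼ (gcd (r', m'₀, …, m'ⱼ₋₁) - gcd (r', m'₀, …, m'ⱼ))`. -/
def levelSum (r r' : ℕ) (S : Finset Exponent) : ℤ :=
  ∑ k ∈ S, (numer r k : ℤ) *
    ((gcdOf r' (S.filter fun l => k < l) : ℤ) - (gcdOf r' (S.filter fun l => k ≤ l) : ℤ))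

/-- The loop multiplicity of `⟨q⟩`. For `q = 0` this is `0`. -/
def loopMult (q : ExpFactor) : ℤ :=
  levelSum (ram q) (ram q) q.support - (ram q : ℤ) ^ 2 + 1

/-- The truncation `τ_c q`: the monomials of `q` with exponent at least `c`. -/
def trunc (c : ℚ) (q : ExpFactor) : ExpFactor := q.filter fun k => c ≤ (k : ℚ)

/-- The smallest `c ∈ (1 / lcm (r, r')) ℤ_{>0}` such that `⟨τ_c q⟩ = ⟨τ_c q'⟩`. -/
def cutoff (q q' : ExpFactor) : ℚ :=
  ((sInf {m : ℕ | 0 < m ∧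
      circ (trunc ((m : ℚ) / (Nat.lcm (ram q) (ram q') : ℚ)) q) =
        circ (trunc ((m : ℚ) / (Nat.lcm (ram q) (ram q') : ℚ)) q')} : ℕ) : ℚ) /
    (Nat.lcm (ram q) (ram q') : ℚ)

/-- The part of `q` common with `q'`. -/
def commonPart (q q' : ExpFactor) : ExpFactor := trunc (cutoff q q') q

/-- The part of `q` different from `q'`, so that `q = commonPart q q' + diffPart q q'`. -/
def diffPart (q q' : ExpFactor) : ExpFactor := q - commonPart q q'

/-- The formula for the edge multiplicity of `⟨q⟩ ≠ ⟨q'⟩` when the different part of `q` has slope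
at least that of the different part of `q'`, so that this slope is the fission exponent. -/
def edgeFormula (q q' : ExpFactor) : ℤ :=
  levelSum (ram q) (ram q') (commonPart q q').support
    + (numer (ram q) (slope (diffPart q q')) : ℤ) * (gcdOf (ram q') (commonPart q q').support : ℤ)
    - (ram q : ℤ) * (ram q' : ℤ)

/-- The edge multiplicity of two exponential factors with distinct Stokes circles. -/
def edgeMult (q q' : ExpFactor) : ℤ :=
  if slope (diffPart q' q) ≤ slope (diffPart q q') then edgeFormula q q' else edgeFormula q' q

theorem GaloisConj.trunc {q q' : ExpFactor} (h : GaloisConj q q') (c : ℚ) :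
    GaloisConj (trunc c q) (trunc c q') := by
  obtain ⟨n, hn⟩ := h
  refine ⟨n, fun k => ?_⟩
  by_cases hk : c ≤ (k : ℚ) <;> simp [NAHodge.trunc, hk, hn k]

theorem GaloisConj.circ_eq {q q' : ExpFactor} (h : GaloisConj q q') : circ q = circ q' :=
  Quotient.sound h

theorem GaloisConj.cutoff_eq {p p' q q' : ExpFactor} (hp : GaloisConj p p')
    (hq : GaloisConj q q') : cutoff p' q' = cutoff p q := by
  unfold cutoff
  rw [hp.ram_eq, hq.ram_eq]
  simp only [← (hp.trunc _).circ_eq, ← (hq.trunc _).circ_eq]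

theorem GaloisConj.commonPart {p p' q q' : ExpFactor} (hp : GaloisConj p p')
    (hq : GaloisConj q q') : GaloisConj (commonPart p q) (commonPart p' q') := by
  unfold NAHodge.commonPart
  rw [hp.cutoff_eq hq]
  exact hp.trunc _

theorem GaloisConj.diffPart {p p' q q' : ExpFactor} (hp : GaloisConj p p')
    (hq : GaloisConj q q') : GaloisConj (diffPart p q) (diffPart p' q') := by
  unfold NAHodge.diffPart NAHodge.commonPart
  rw [hp.cutoff_eq hq]
  obtain ⟨n, hn⟩ := hp
  refine ⟨n, fun k => ?_⟩
  by_cases hk : NAHodge.cutoff p q ≤ (k : ℚ) <;> simp [NAHodge.trunc, hk, hn k]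

theorem GaloisConj.slope_eq {q q' : ExpFactor} (h : GaloisConj q q') : slope q' = slope q := by
  unfold slope; rw [h.support_eq]

theorem GaloisConj.loopMult_eq {q q' : ExpFactor} (h : GaloisConj q q') :
    loopMult q' = loopMult q := by
  unfold loopMult; rw [h.support_eq, h.ram_eq]

theorem GaloisConj.edgeFormula_eq {p p' q q' : ExpFactor} (hp : GaloisConj p p')
    (hq : GaloisConj q q') : edgeFormula p' q' = edgeFormula p q := by
  unfold edgeFormula
  rw [hp.ram_eq, hq.ram_eq, (hp.commonPart hq).support_eq, (hp.diffPart hq).slope_eq]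

theorem GaloisConj.edgeMult_eq {p p' q q' : ExpFactor} (hp : GaloisConj p p')
    (hq : GaloisConj q q') : edgeMult p' q' = edgeMult p q := by
  unfold edgeMult
  rw [hp.edgeFormula_eq hq, hq.edgeFormula_eq hp, (hp.diffPart hq).slope_eq,
    (hq.diffPart hp).slope_eq]

/-- The ramification order of a Stokes circle. -/
def StokesCircle.ram : StokesCircle → ℕ :=
  Quotient.lift NAHodge.ram fun _ _ h => (GaloisConj.ram_eq h).symm

/-- The loop multiplicity `B_{I,I}` of a Stokes circle. -/
def StokesCircle.loopMult : StokesCircle → ℤ :=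
  Quotient.lift NAHodge.loopMult fun _ _ h => (GaloisConj.loopMult_eq h).symm

/-- The edge multiplicity `B_{I,J}` of two distinct Stokes circles. -/
def StokesCircle.edgeMult : StokesCircle → StokesCircle → ℤ :=
  Quotient.lift₂ NAHodge.edgeMult fun _ _ _ _ h h' => (GaloisConj.edgeMult_eq h h').symm

open Classical in
/-- The multiplicity `B_{I,J}` of a pair of Stokes circles: the loop multiplicity if `I = J`, the
edge multiplicity otherwise. -/
def StokesCircle.mult (I J : StokesCircle) : ℤ :=
  if I = J then I.loopMult else I.edgeMult J

/-! ### Irregular classes and core diagrams -/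

/-- An irregular class at infinity: a finite multiset `Θ = ∑ nᵢ Iᵢ` of Stokes circles. -/
abbrev IrregularClass : Type := Multiset StokesCircle

/-- An irregular class is untwisted if all its Stokes circles have ramification order `1`. -/
def IrregularClass.IsUntwisted (Θ : IrregularClass) : Prop := ∀ I ∈ Θ, StokesCircle.ram I = 1

/-- `Γ = Γ_c(Θ)`: the vertices of `Γ` are identified with the distinct Stokes circles of `Θ`, in
such a way that the entries of the matrix of `Γ` are the multiplicities of pairs of circles. -/
def Diagram.IsCoreDiagramOf (Γ : Diagram) (Θ : IrregularClass) : Prop :=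
  ∃ e : Γ.N ≃ {I : StokesCircle // I ∈ Θ},
    ∀ i j, Γ.B i j = StokesCircle.mult (e i : StokesCircle) (e j : StokesCircle)

/-! ### Algebraic connections on the affine line -/

/-- An algebraic connection `(E, ∇)` on the complex affine line: a finitely generated projective
`ℂ[z]`-module `E` (an algebraic vector bundle) with an additive operator `∇ = ∇_{d/dz}` on `E`
satisfying the Leibniz rule (which makes it `ℂ`-linear). -/
structure AlgConnection where
  E : Type
  [addCommGroup : AddCommGroup E]
  [module : Module ℂ[X] E]
  [finite : Module.Finite ℂ[X] E]
  [projective : Module.Projective ℂ[X] E]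
  nabla : E →+ E
  leibniz : ∀ (f : ℂ[X]) (v : E),
    nabla (f • v) = Polynomial.derivative f • v + f • nabla v

attribute [instance] AlgConnection.addCommGroup AlgConnection.module AlgConnection.finite
  AlgConnection.projective

/-- The connection `∇ = d - A dz` on the trivial bundle of rank `n`. -/
def AlgConnection.ofMatrix {n : ℕ} (A : Matrix (Fin n) (Fin n) ℂ[X]) : AlgConnection where
  E := Fin n → ℂ[X]
  nabla :=
    { toFun := fun v => (fun i => Polynomial.derivative (v i)) - A.mulVec v
      map_zero' := by
        ext1 i
        simp
      map_add' := by
        intro v w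
        ext1 i
        simp [Matrix.mulVec_add]
        ring }
  leibniz := by
    intro f v
    ext1 i
    simp [Matrix.mulVec_smul, Polynomial.derivative_mul]
    ring

/-- The matrix `A` such that `∇ = d - A dz` in a basis `b` of `E`. -/
def AlgConnection.matrix (C : AlgConnection) {n : ℕ} (b : Module.Basis (Fin n) ℂ[X] C.E) :
    Matrix (Fin n) (Fin n) ℂ[X] :=
  Matrix.of fun i j => - b.repr (C.nabla (b j)) i

/-- The embedding of `ℂ[z]` in `ℂ((t))`, where `z = t ^ (-r)`. -/
def polyToLaurent (r : ℕ) : ℂ[X] →ₐ[ℂ] LaurentSeries ℂ :=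
  Polynomial.aeval (HahnSeries.single (-(r : ℤ)) (1 : ℂ) : LaurentSeries ℂ)

/-- The derivation `d/dz = -(1/r) t ^ (r+1) d/dt` of `ℂ((t))`, where `z = t ^ (-r)`. -/
def zDeriv (r : ℕ) (f : LaurentSeries ℂ) : LaurentSeries ℂ :=
  (HahnSeries.single ((r : ℤ) + 1) (-(1 / (r : ℂ))) : LaurentSeries ℂ) *
    LaurentSeries.hasseDeriv ℂ 1 f

/-- The exponential factor `q` as an element of `ℂ((t))`, where `z = t ^ (-r)` and the ramification
order of `q` divides `r`: the monomial `a z ^ k` becomes `a t ^ (- r k)`. -/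
def ExpFactor.toLaurent (r : ℕ) (q : ExpFactor) : LaurentSeries ℂ :=
  q.sum fun k a => HahnSeries.single (-(numer r k : ℤ)) a

/-- The Turrittin-Levelt normal form at infinity of the system `v' = A v`: after a pullback
`z = t ^ (-r)` and a gauge transformation `v = G w` with `G` an invertible matrix over `ℂ((t))`,
the system becomes `w' = (Q' + Λ / z) w`, where `' = d/dz`, `Q` is the diagonal matrix of the
exponential factors `q i` and `Λ` is a constant matrix commuting with `Q`. Thus a formal fundamental
matrix of solutions is `G z ^ Λ e ^ Q`. -/
def HasNormalForm {n : ℕ} (A : Matrix (Fin n) (Fin n) ℂ[X]) (q : Fin n → ExpFactor) : Prop :=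
  ∃ (r : ℕ) (G : Matrix (Fin n) (Fin n) (LaurentSeries ℂ)) (Λ : Matrix (Fin n) (Fin n) ℂ),
    1 ≤ r ∧ (∀ i, ram (q i) ∣ r) ∧ IsUnit G ∧ (∀ i j, q i ≠ q j → Λ i j = 0) ∧
    A.map (polyToLaurent r) * G - G.map (zDeriv r) =
      G * (Matrix.diagonal (fun i => zDeriv r ((q i).toLaurent r)) +
        Λ.map fun a => (HahnSeries.single (r : ℤ) a : LaurentSeries ℂ))

open Classical in
/-- `Θ` is the irregular class of the connection at infinity: in a normal form of the connection
at infinity, every exponential factor `p` occurs exactly as many times as its Stokes circle `⟨p⟩`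
occurs in `Θ`. -/
def AlgConnection.HasIrregularClass (C : AlgConnection) (Θ : IrregularClass) : Prop :=
  ∃ (n : ℕ) (b : Module.Basis (Fin n) ℂ[X] C.E) (q : Fin n → ExpFactor),
    HasNormalForm (C.matrix b) q ∧
    ∀ p : ExpFactor, Nat.card {i : Fin n // q i = p} = Multiset.count (circ p) Θ

/-- A nonabelian Hodge diagram: the core diagram of an algebraic connection on the affine line. -/
def Diagram.IsNonabelianHodgeDiagram (Γ : Diagram) : Prop :=
  ∃ (C : AlgConnection) (Θ : IrregularClass), C.HasIrregularClass Θ ∧ Γ.IsCoreDiagramOf Θ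

/-- A nonabelian Hodge graph: a nonabelian Hodge diagram that is a graph. -/
def Diagram.IsNonabelianHodgeGraph (Γ : Diagram) : Prop :=
  Γ.IsNonabelianHodgeDiagram ∧ Γ.IsGraph

/-- A fission graph: the core diagram of an algebraic connection on the affine line with untwisted
irregular class. -/
def Diagram.IsFissionGraph (Γ : Diagram) : Prop :=
  ∃ (C : AlgConnection) (Θ : IrregularClass), C.HasIrregularClass Θ ∧ Θ.IsUntwisted ∧
    Γ.IsCoreDiagramOf Θ

/-! ### The example -/

open Polynomial in
/-- The block diagonal matrix with the three blocks
`(a z²)`, `(0 1 0; 0 0 1; b z 0 0)` and `(0 1; c z 0)`. -/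
def exampleMatrix (a b c : ℂ) : Matrix (Fin 6) (Fin 6) ℂ[X] :=
  !![C a * X ^ 2, 0, 0, 0, 0, 0;
     0, 0, 1, 0, 0, 0;
     0, 0, 0, 1, 0, 0;
     0, C b * X, 0, 0, 0, 0;
     0, 0, 0, 0, 0, 1;
     0, 0, 0, 0, C c * X, 0]

/-- The loopless triangle with edge multiplicities `3`, `4`, `6`. -/
def triangle346 : Diagram where
  N := Fin 3
  finite_N := inferInstance
  B := !![0, 6, 4; 6, 0, 3; 4, 3, 0]
  symm := by intro i j; fin_cases i <;> fin_cases j <;> rfl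
  even_loop := by intro i; fin_cases i <;> exact ⟨0, rfl⟩

end NAHodge

end

open NAHodge

/-!
The blocks of the example are companion matrices of equations `y ^ (n) = b z ^ m y`, where `(n)` is
the order of derivation. After a pullback `z = t ^ (-r)`, such an equation has `n` formal solutions
`z ^ e P(z ^ (-μ)) exp(a z ^ μ)` with `μ = 1 + m / n` and `P` a power series, whose coefficients are
determined recursively; the `a z ^ μ` form the Galois orbit of one of them when `μ` has denominator
`n`, and the solutions give the columns of the gauge transformation to normal form.

Factors without common exponents have multiplicity `r r' (max slope - 1)`, which produces the
triangle with edges `3`, `4`, `6`. Polynomials `q ≠ q'` in `z` have multiplicity `deg (q - q') - 1`,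
and `deg (q - q')` is an ultrametric distance; hence all fission graphs are ultrametric.
-/

noncomputable section

namespace NAHodge

open scoped PowerSeries

section FormalPowerSeries

open PowerSeries

variable {K : Type*} [Field K]

/-- The operator `P ↦ β P + X (a P - μ X P')`, such that `d/dz` maps the formal function
`z ^ a P(z ^ (-μ)) exp(β z ^ μ / μ)` to
`z ^ (a + μ - 1) (eulerOp β a μ P)(z ^ (-μ)) exp(β z ^ μ / μ)`. -/
def eulerOp (β a μ : K) : K⟦X⟧ →ₗ[K] K⟦X⟧ :=
  β • LinearMap.id + LinearMap.mulLeft K X ∘ₗ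
    (a • LinearMap.id -
      μ • LinearMap.mulLeft K X ∘ₗ (derivative K).toLinearMap)

theorem eulerOp_apply (β a μ : K) (P : K⟦X⟧) :
    eulerOp β a μ P =
      β • P + X * (a • P - μ • (X * derivative K P)) :=
  rfl

theorem coeff_zero_eulerOp (β a μ : K) (P : K⟦X⟧) :
    coeff 0 (eulerOp β a μ P) = β * coeff 0 P := by
  simp [eulerOp_apply]

theorem coeff_succ_eulerOp (β a μ : K) (P : K⟦X⟧) (k : ℕ) :
    coeff (k + 1) (eulerOp β a μ P) =
      β * coeff (k + 1) P + (a - μ * k) * coeff k P := by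
  cases k
  · simp [eulerOp_apply, coeff_succ_X_mul]
  · simp [eulerOp_apply, coeff_succ_X_mul, coeff_derivative]
    ring

/-- The composition `eulerOp β (a (n - 1)) μ ∘ ⋯ ∘ eulerOp β (a 0) μ`, which computes the `n`-th
derivative of a formal solution. -/
def eulerIter (β μ : K) (a : ℕ → K) : ℕ → K⟦X⟧ →ₗ[K] K⟦X⟧
  | 0 => LinearMap.id
  | n + 1 => eulerOp β (a n) μ ∘ₗ eulerIter β μ a n

theorem eulerIter_succ (β μ : K) (a : ℕ → K) (n : ℕ) (P : K⟦X⟧) :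
    eulerIter β μ a (n + 1) P = eulerOp β (a n) μ (eulerIter β μ a n P) :=
  rfl

theorem coeff_zero_eulerIter (β μ : K) (a : ℕ → K) (n : ℕ) (P : K⟦X⟧) :
    coeff 0 (eulerIter β μ a n P) = β ^ n * coeff 0 P := by
  induction n with
  | zero => simp [eulerIter]
  | succ n ih => rw [eulerIter_succ, coeff_zero_eulerOp, ih]; ring

theorem X_pow_succ_dvd_iff {n : ℕ} {P : K⟦X⟧} :
    X ^ (n + 1) ∣ P ↔ X ^ n ∣ P ∧ coeff n P = 0 := by
  simp only [X_pow_dvd_iff, Nat.forall_lt_succ_right]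

theorem X_pow_dvd_eulerOp (β a μ : K) {k : ℕ} {P : K⟦X⟧} (hP : X ^ k ∣ P) :
    X ^ k ∣ eulerOp β a μ P := by
  rw [X_pow_dvd_iff] at hP ⊢
  rintro (_ | m) hm
  · rw [coeff_zero_eulerOp, hP 0 hm, mul_zero]
  · rw [coeff_succ_eulerOp, hP _ hm, hP m (by omega), mul_zero, mul_zero, add_zero]

theorem X_pow_dvd_eulerIter (β μ : K) (a : ℕ → K) (n : ℕ) {k : ℕ} {P : K⟦X⟧}
    (hP : X ^ k ∣ P) : X ^ k ∣ eulerIter β μ a n P := by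
  induction n with
  | zero => exact hP
  | succ n ih => exact X_pow_dvd_eulerOp β (a n) μ ih

theorem coeff_eulerIter_of_X_pow_dvd (β μ : K) (a : ℕ → K) (n : ℕ) {k : ℕ} {P : K⟦X⟧}
    (hP : X ^ k ∣ P) :
    coeff k (eulerIter β μ a n P) = β ^ n * coeff k P := by
  induction n with
  | zero => simp [eulerIter]
  | succ n ih =>
    have hlow := X_pow_dvd_iff.1 (X_pow_dvd_eulerIter β μ a n hP)
    rw [eulerIter_succ]
    cases k with
    | zero => rw [coeff_zero_eulerOp, ih]; ring
    | succ k => rw [coeff_succ_eulerOp, ih, hlow k k.lt_succ_self]; ring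

theorem coeff_succ_eulerIter_of_X_pow_dvd (β μ : K) (a : ℕ → K) (n : ℕ) {k : ℕ} {P : K⟦X⟧}
    (hP : X ^ k ∣ P) :
    β * coeff (k + 1) (eulerIter β μ a n P) =
      β ^ (n + 1) * coeff (k + 1) P +
        β ^ n * (∑ i ∈ Finset.range n, a i - n * μ * k) * coeff k P := by
  induction n with
  | zero => simp [eulerIter]
  | succ n ih =>
    rw [eulerIter_succ, coeff_succ_eulerOp, ih, coeff_eulerIter_of_X_pow_dvd β μ a n hP,
      Finset.sum_range_succ]
    push_cast
    ring

/-- Approximate solutions of `L P = 0` with constant coefficient `1`, where `L` raises the order of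
a series by one and multiplies the leading coefficient of a series of order `k` by `c k`: each one
corrects the next coefficient of the previous one. -/
def approxKer (L : K⟦X⟧ →ₗ[K] K⟦X⟧) (c : ℕ → K) : ℕ → K⟦X⟧
  | 0 => 1
  | k + 1 => approxKer L c k -
      C (coeff (k + 2) (L (approxKer L c k)) / c (k + 1)) *
        X ^ (k + 1)

theorem coeff_approxKer (L : K⟦X⟧ →ₗ[K] K⟦X⟧) (c : ℕ → K) {j n : ℕ} (hjn : j ≤ n) :
    coeff j (approxKer L c n) = coeff j (approxKer L c j) := by
  induction n, hjn using Nat.le_induction with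
  | base => rfl
  | succ n hjn ih =>
    rw [approxKer, map_sub, ih, coeff_C_mul_X_pow, if_neg (by omega), sub_zero]

theorem X_pow_dvd_map_approxKer {L : K⟦X⟧ →ₗ[K] K⟦X⟧} {c : ℕ → K}
    (hL : ∀ (k : ℕ) (D : K⟦X⟧), X ^ k ∣ D → X ^ (k + 1) ∣ L D)
    (hLc : ∀ (k : ℕ) (D : K⟦X⟧), X ^ k ∣ D →
      coeff (k + 1) (L D) = c k * coeff k D)
    (hc₀ : c 0 = 0) (hc : ∀ k, c (k + 1) ≠ 0) (k : ℕ) :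
    X ^ (k + 2) ∣ L (approxKer L c k) := by
  induction k with
  | zero =>
    refine X_pow_succ_dvd_iff.2 ⟨hL 0 1 (one_dvd 1), ?_⟩
    simpa [hc₀, approxKer] using hLc 0 1 (one_dvd 1)
  | succ k ih =>
    rw [approxKer, map_sub]
    refine X_pow_succ_dvd_iff.2 ⟨dvd_sub ih (hL _ _ (dvd_mul_left _ _)), ?_⟩
    rw [map_sub, hLc _ _ (dvd_mul_left _ _), coeff_C_mul_X_pow, if_pos rfl,
      mul_div_cancel₀ _ (hc k), sub_self]

theorem exists_constantCoeff_eq_one_and_map_eq_zero {L : K⟦X⟧ →ₗ[K] K⟦X⟧} {c : ℕ → K}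
    (hL : ∀ (k : ℕ) (D : K⟦X⟧), X ^ k ∣ D → X ^ (k + 1) ∣ L D)
    (hLc : ∀ (k : ℕ) (D : K⟦X⟧), X ^ k ∣ D →
      coeff (k + 1) (L D) = c k * coeff k D)
    (hc₀ : c 0 = 0) (hc : ∀ k, c (k + 1) ≠ 0) :
    ∃ P : K⟦X⟧, constantCoeff P = 1 ∧ L P = 0 := by
  set P : K⟦X⟧ := mk fun k => coeff k (approxKer L c k) with hPdef
  refine ⟨P, by simp [hPdef, ← coeff_zero_eq_constantCoeff_apply, approxKer], ?_⟩
  have hP (n : ℕ) : X ^ (n + 1) ∣ P - approxKer L c n := by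
    refine X_pow_dvd_iff.2 fun m hm => ?_
    rw [map_sub, hPdef, coeff_mk, coeff_approxKer L c (Nat.lt_succ_iff.1 hm), sub_self]
  have hLP (n : ℕ) : X ^ (n + 2) ∣ L P := by
    have h := dvd_add (hL _ _ (hP n)) (X_pow_dvd_map_approxKer hL hLc hc₀ hc n)
    rwa [← map_add, sub_add_cancel] at h
  ext n
  exact X_pow_dvd_iff.1 (hLP n) n (by omega)

theorem exists_eulerIter_eq_smul [CharZero K] {β μ : K} (hβ : β ≠ 0) (hμ : μ ≠ 0) {a : ℕ → K}
    {n : ℕ} (hn : n ≠ 0) (ha : ∑ i ∈ Finset.range n, a i = 0) :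
    ∃ P : K⟦X⟧, constantCoeff P = 1 ∧ eulerIter β μ a n P = β ^ n • P := by
  refine (exists_constantCoeff_eq_one_and_map_eq_zero
    (L := β • (eulerIter β μ a n - β ^ n • LinearMap.id)) (c := fun k => -(β ^ n * n * μ * k))
    (fun k D hD => ?_) (fun k D hD => ?_) (by simp) (fun k => ?_)).imp fun P hP => ⟨hP.1, ?_⟩
  · refine X_pow_succ_dvd_iff.2 ⟨?_, by simp [coeff_eulerIter_of_X_pow_dvd β μ a n hD]⟩
    have h := dvd_sub (X_pow_dvd_eulerIter β μ a n hD)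
      (hD.mul_left (C (β ^ n)))
    simpa [smul_eq_C_mul] using h.mul_left (C β)
  · have h := coeff_succ_eulerIter_of_X_pow_dvd β μ a n hD
    simp only [LinearMap.smul_apply, LinearMap.sub_apply, LinearMap.id_apply, map_smul, map_sub,
      smul_eq_mul]
    rw [mul_sub, h, ha]
    ring
  · simp [hβ, hμ, hn, Nat.cast_add_one_ne_zero]
  · simpa [hβ, sub_eq_zero] using hP.2

end FormalPowerSeries

theorem zDeriv_coeff (r : ℕ) (f : LaurentSeries ℂ) (n : ℤ) :
    (zDeriv r f).coeff n = -(1 / (r : ℂ)) * (((n - r : ℤ) : ℂ) * f.coeff (n - r)) := by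
  rw [zDeriv, HahnSeries.coeff_single_mul, LaurentSeries.hasseDeriv_coeff]
  have h : n - ((r : ℤ) + 1) + (1 : ℕ) = n - r := by push_cast; ring
  rw [h, Ring.choose_one_right, zsmul_eq_mul]

theorem zDeriv_single (r : ℕ) (n : ℤ) (a : ℂ) :
    zDeriv r (HahnSeries.single n a) = HahnSeries.single (n + r) (-(n / r) * a) := by
  rw [zDeriv, LaurentSeries.hasseDeriv_single, HahnSeries.single_mul_single,
    Ring.choose_one_right, zsmul_eq_mul]
  congr 1
  · congr 1
    push_cast
    ring
  · ring

theorem zDeriv_zero (r : ℕ) : zDeriv r 0 = 0 := by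
  rw [zDeriv, map_zero, mul_zero]

/-- The Laurent series `t ^ e * P(t ^ d)`. -/
def powSeries (e : ℤ) {d : ℕ} (hd : d ≠ 0) (P : ℂ⟦X⟧) : LaurentSeries ℂ :=
  HahnSeries.single e 1 * HahnSeries.ofPowerSeries ℤ ℂ (PowerSeries.expand d hd P)

section PowSeries

variable (e : ℤ) {d : ℕ} (hd : d ≠ 0) (P : ℂ⟦X⟧)

theorem coeff_powSeries_add_mul (k : ℕ) :
    (powSeries e hd P).coeff (e + d * k) = PowerSeries.coeff k P := by
  rw [powSeries, HahnSeries.coeff_single_mul, one_mul, add_sub_cancel_left, ← Nat.cast_mul,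
    ← PowerSeries.coeff_expand_mul d hd]
  exact HahnSeries.ofPowerSeries_apply_coeff _ _

theorem coeff_powSeries_eq_zero {n : ℤ} (hn : ∀ k : ℕ, n ≠ e + d * k) :
    (powSeries e hd P).coeff n = 0 := by
  rw [powSeries, HahnSeries.coeff_single_mul, one_mul, PowerSeries.coeff_coe]
  split_ifs with h
  · rfl
  · refine PowerSeries.coeff_expand_of_not_dvd d hd _ ?_
    rintro ⟨k, hk⟩
    refine hn k ?_
    have : ((n - e).natAbs : ℤ) = d * k := mod_cast hk
    omega

theorem powSeries_smul (c : ℂ) :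
    powSeries e hd (c • P) = powSeries e hd P * HahnSeries.single 0 c := by
  rw [powSeries, powSeries, PowerSeries.expand_smul, PowerSeries.smul_eq_C_mul, map_mul,
    HahnSeries.ofPowerSeries_C, HahnSeries.C_apply]
  ring

theorem powSeries_mul_single (f : ℤ) :
    powSeries e hd P * HahnSeries.single f 1 = powSeries (e + f) hd P := by
  rw [powSeries, powSeries, mul_right_comm, HahnSeries.single_mul_single, one_mul]

theorem zDeriv_powSeries_add_mul_single (r : ℕ) (β : ℂ) :
    zDeriv r (powSeries e hd P) + powSeries e hd P * HahnSeries.single ((r : ℤ) - d) β =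
      powSeries (e + r - d) hd (eulerOp β (-(e / r)) (d / r) P) := by
  ext n
  rw [HahnSeries.coeff_add, zDeriv_coeff, HahnSeries.coeff_mul_single]
  by_cases h : ∃ k : ℕ, n = e + r - d + d * k
  · obtain ⟨k, rfl⟩ := h
    rw [coeff_powSeries_add_mul,
      show e + r - d + d * (k : ℤ) - (r - d) = e + d * k by ring, coeff_powSeries_add_mul]
    cases k with
    | zero =>
      rw [coeff_powSeries_eq_zero, coeff_zero_eulerOp]
      · ring
      · intro k hk
        have hpos : (0 : ℤ) < d * (k + 1) :=
          mul_pos (mod_cast Nat.pos_of_ne_zero hd) (by positivity)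
        push_cast at hk
        linarith
    | succ k =>
      rw [coeff_succ_eulerOp,
        show e + r - d + d * ((k + 1 : ℕ) : ℤ) - r = e + d * k by push_cast; ring,
        coeff_powSeries_add_mul]
      push_cast
      ring
  · push Not at h
    rw [coeff_powSeries_eq_zero _ _ _ h, coeff_powSeries_eq_zero, coeff_powSeries_eq_zero]
    · ring
    · intro k hk
      exact h k (by linarith)
    · intro k hk
      exact h (k + 1) (by push_cast; linarith)

end PowSeries

theorem isUnit_powSeries_of_injective {n : ℕ} (e : Fin n → ℤ) {d : ℕ} (hd : d ≠ 0)
    {β : Fin n → ℂ} (hβ : Function.Injective β) {P : Fin n → Fin n → ℂ⟦X⟧}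
    (hP : ∀ i j, PowerSeries.constantCoeff (P i j) = β j ^ (i : ℕ)) :
    IsUnit (Matrix.of fun i j => powSeries (e i) hd (P i j)) := by
  have hvand : (Matrix.of P).map PowerSeries.constantCoeff = (Matrix.vandermonde β).transpose := by
    ext i j
    simp [hP, Matrix.vandermonde_apply]
  have hunit : IsUnit (Matrix.of P) := by
    rw [Matrix.isUnit_iff_isUnit_det, PowerSeries.isUnit_iff_constantCoeff, RingHom.map_det,
      RingHom.mapMatrix_apply, hvand, Matrix.det_transpose, isUnit_iff_ne_zero]
    exact Matrix.det_vandermonde_ne_zero_iff.2 hβ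
  have hdiag : IsUnit (Matrix.diagonal fun i => (HahnSeries.single (e i) 1 : LaurentSeries ℂ)) :=
    Matrix.isUnit_diagonal.2 <| Pi.isUnit_iff.2 fun i => by simp
  convert hdiag.mul (hunit.map ((HahnSeries.ofPowerSeries ℤ ℂ).comp
    (PowerSeries.expand d hd).toRingHom).mapMatrix) using 1
  ext1 i j
  rw [Matrix.diagonal_mul]
  rfl

section NormalForm

variable {ι κ : Type*} [Fintype ι] [Fintype κ] [DecidableEq ι] [DecidableEq κ]

/-- The Turrittin-Levelt normal form of `HasNormalForm`, over the fixed ramified covering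
`z = t ^ (-r)` and for matrices indexed by an arbitrary finite type. -/
def HasNormalFormOver (r : ℕ) (A : Matrix ι ι ℂ[X]) (q : ι → ExpFactor) : Prop :=
  ∃ (G : Matrix ι ι (LaurentSeries ℂ)) (Λ : Matrix ι ι ℂ),
    (∀ i, ram (q i) ∣ r) ∧ IsUnit G ∧ (∀ i j, q i ≠ q j → Λ i j = 0) ∧
    A.map (polyToLaurent r) * G - G.map (zDeriv r) =
      G * (Matrix.diagonal (fun i => zDeriv r ((q i).toLaurent r)) +
        Λ.map fun a => (HahnSeries.single (r : ℤ) a : LaurentSeries ℂ))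

open Classical in
/-- The irregular class `Θ` of the system `v' = A v`, read off from a normal form over the fixed
ramified covering `z = t ^ (-r)`. -/
def HasIrregularClassOver (r : ℕ) (A : Matrix ι ι ℂ[X]) (Θ : IrregularClass) : Prop :=
  ∃ q : ι → ExpFactor, HasNormalFormOver r A q ∧
    ∀ p : ExpFactor, Nat.card {i // q i = p} = Multiset.count (circ p) Θ

theorem HasNormalFormOver.fromBlocks {r : ℕ} {A : Matrix ι ι ℂ[X]} {B : Matrix κ κ ℂ[X]}
    {q : ι → ExpFactor} {p : κ → ExpFactor} (hA : HasNormalFormOver r A q)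
    (hB : HasNormalFormOver r B p) :
    HasNormalFormOver r (Matrix.fromBlocks A 0 0 B) (Sum.elim q p) := by
  obtain ⟨G, Λ, hram, hG, hΛ, h⟩ := hA
  obtain ⟨H, M, hram', hH, hM, h'⟩ := hB
  refine ⟨Matrix.fromBlocks G 0 0 H, Matrix.fromBlocks Λ 0 0 M, Sum.rec hram hram',
    Matrix.isUnit_fromBlocks_zero₂₁.2 ⟨hG, hH⟩, ?_, ?_⟩
  · rintro (i | i) (j | j) hij
    exacts [hΛ i j hij, rfl, rfl, hM i j hij]
  · have hdiag : (fun i => zDeriv r ((Sum.elim q p i).toLaurent r)) = Sum.elim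
        (fun i => zDeriv r ((q i).toLaurent r)) fun i => zDeriv r ((p i).toLaurent r) :=
      (Sum.comp_elim (fun s : ExpFactor => zDeriv r (s.toLaurent r)) q p)
    rw [hdiag, ← Matrix.fromBlocks_diagonal]
    simp only [Matrix.fromBlocks_map, Matrix.fromBlocks_multiply, Matrix.fromBlocks_add,
      Matrix.map_zero _ (map_zero _), Matrix.map_zero _ (zDeriv_zero r),
      Matrix.zero_mul, Matrix.mul_zero, add_zero,
      zero_add, ← h, ← h', sub_eq_add_neg, Matrix.fromBlocks_neg, neg_zero]

theorem HasIrregularClassOver.fromBlocks {r : ℕ} {A : Matrix ι ι ℂ[X]} {B : Matrix κ κ ℂ[X]}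
    {Θ Ξ : IrregularClass} (hA : HasIrregularClassOver r A Θ) (hB : HasIrregularClassOver r B Ξ) :
    HasIrregularClassOver r (Matrix.fromBlocks A 0 0 B) (Θ + Ξ) := by
  classical
  obtain ⟨q, hq, hΘ⟩ := hA
  obtain ⟨p, hp, hΞ⟩ := hB
  refine ⟨Sum.elim q p, hq.fromBlocks hp, fun s => ?_⟩
  rw [Nat.card_congr (Equiv.subtypeSum ..), Nat.card_sum]
  simp only [Sum.elim_inl, Sum.elim_inr]
  convert congrArg₂ (· + ·) (hΘ s) (hΞ s)
  exact Multiset.count_add ..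

theorem HasNormalFormOver.reindex {r : ℕ} {A : Matrix ι ι ℂ[X]} {q : ι → ExpFactor}
    (h : HasNormalFormOver r A q) (e : ι ≃ κ) :
    HasNormalFormOver r (A.reindex e e) (q ∘ e.symm) := by
  obtain ⟨G, Λ, hram, hG, hΛ, h⟩ := h
  refine ⟨G.reindex e e, Λ.reindex e e, fun i => hram _, (Matrix.isUnit_submatrix_equiv ..).2 hG,
    fun i j => hΛ _ _, ?_⟩
  have h' := congrArg (Matrix.reindex e e) h
  simp only [Matrix.reindex_apply, Matrix.submatrix_sub, Matrix.submatrix_add, Pi.sub_apply,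
    Pi.add_apply, ← Matrix.submatrix_mul_equiv _ _ _ e.symm, Matrix.submatrix_diagonal_equiv] at h'
  simpa [Matrix.submatrix_map, Function.comp_def] using h'

theorem HasIrregularClassOver.reindex {r : ℕ} {A : Matrix ι ι ℂ[X]} {Θ : IrregularClass}
    (h : HasIrregularClassOver r A Θ) (e : ι ≃ κ) : HasIrregularClassOver r (A.reindex e e) Θ := by
  obtain ⟨q, hq, hΘ⟩ := h
  refine ⟨q ∘ e.symm, hq.reindex e, fun p => ?_⟩
  rw [← hΘ p]
  exact Nat.card_congr (e.symm.subtypeEquiv fun _ => Iff.rfl)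

theorem AlgConnection.matrix_ofMatrix {n : ℕ} (A : Matrix (Fin n) (Fin n) ℂ[X]) :
    (AlgConnection.ofMatrix A).matrix (Pi.basisFun ℂ[X] (Fin n)) = A := by
  ext1 i j
  change -((fun l => Polynomial.derivative (Pi.basisFun ℂ[X] (Fin n) j l)) -
    A.mulVec (Pi.basisFun ℂ[X] (Fin n) j)) i = A i j
  have hconst : (fun l => Polynomial.derivative (Pi.basisFun ℂ[X] (Fin n) j l)) = 0 := by
    ext1 l
    rw [Pi.basisFun_apply, Pi.single_apply]
    split_ifs <;> simp
  rw [hconst, zero_sub, Pi.neg_apply, neg_neg, Pi.basisFun_apply, Matrix.mulVec_single_one,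
    Matrix.col_apply]

theorem HasIrregularClassOver.hasIrregularClass {r n : ℕ} (hr : r ≠ 0)
    {A : Matrix (Fin n) (Fin n) ℂ[X]} {Θ : IrregularClass} (h : HasIrregularClassOver r A Θ) :
    (AlgConnection.ofMatrix A).HasIrregularClass Θ := by
  obtain ⟨q, ⟨G, Λ, hram, hG, hΛ, h⟩, hΘ⟩ := h
  refine ⟨n, Pi.basisFun ℂ[X] (Fin n), q,
    ⟨r, G, Λ, Nat.one_le_iff_ne_zero.2 hr, hram, hG, hΛ, ?_⟩, hΘ⟩
  rwa [AlgConnection.matrix_ofMatrix]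

end NormalForm

theorem exists_powSeries_solution {r d n : ℕ} (hr : r ≠ 0) (hd : d ≠ 0) (hn : n ≠ 0) {β : ℂ}
    (hβ : β ≠ 0) {e : ℕ → ℤ} (he : ∀ i, e (i + 1) = e i + r - d)
    (hsum : ∑ i ∈ Finset.range n, e i = 0) :
    ∃ P : ℕ → ℂ⟦X⟧, (∀ i, PowerSeries.constantCoeff (P i) = β ^ i) ∧
      (∀ i, zDeriv r (powSeries (e i) hd (P i)) +
        powSeries (e i) hd (P i) * HahnSeries.single ((r : ℤ) - d) β =
          powSeries (e (i + 1)) hd (P (i + 1))) ∧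
      powSeries (e n) hd (P n) =
        HahnSeries.single (n * ((r : ℤ) - d)) (β ^ n) * powSeries (e 0) hd (P 0) := by
  set a : ℕ → ℂ := fun i => -(e i / r) with ha
  have hasum : ∑ i ∈ Finset.range n, a i = 0 := by
    rw [ha, Finset.sum_neg_distrib, ← Finset.sum_div, ← Int.cast_sum, hsum, Int.cast_zero, zero_div,
      neg_zero]
  have hμ : (d / r : ℂ) ≠ 0 := div_ne_zero (Nat.cast_ne_zero.2 hd) (Nat.cast_ne_zero.2 hr)
  obtain ⟨P, hP₀, hP⟩ := exists_eulerIter_eq_smul hβ hμ hn hasum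
  refine ⟨fun i => eulerIter β (d / r) a i P, fun i => ?_, fun i => ?_, ?_⟩
  · rw [← PowerSeries.coeff_zero_eq_constantCoeff_apply, coeff_zero_eulerIter,
      PowerSeries.coeff_zero_eq_constantCoeff_apply, hP₀, mul_one]
  · rw [zDeriv_powSeries_add_mul_single, he]
    rfl
  · have hen (i : ℕ) : e i = e 0 + i * ((r : ℤ) - d) := by
      induction i with
      | zero => simp
      | succ i ih => rw [he, ih]; push_cast; ring
    change powSeries (e n) hd (eulerIter β (d / r) a n P) = _ * powSeries (e 0) hd P
    rw [hP, powSeries_smul, hen n, ← powSeries_mul_single, mul_assoc, HahnSeries.single_mul_single,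
      add_zero, one_mul, mul_comm]

/-- The companion matrix of the higher Airy equation `y ^ (N + 1) = b z ^ m y`, where `y ^ (N + 1)`
is the derivative of order `N + 1`. -/
def airyMatrix (N m : ℕ) (b : ℂ) : Matrix (Fin (N + 1)) (Fin (N + 1)) ℂ[X] :=
  Matrix.of fun i j =>
    if j = i + 1 then if i = Fin.last N then Polynomial.C b * Polynomial.X ^ m else 1 else 0

section AiryMatrix

variable {N m r : ℕ} {b : ℂ}

theorem polyToLaurent_C_mul_X_pow (r m : ℕ) (b : ℂ) :
    polyToLaurent r (Polynomial.C b * Polynomial.X ^ m) =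
      HahnSeries.single (-(r * m : ℤ)) b := by
  rw [polyToLaurent, map_mul, map_pow, Polynomial.aeval_C, Polynomial.aeval_X,
    HahnSeries.single_pow, one_pow, HahnSeries.algebraMap_apply',
    PowerSeries.algebraMap_apply, Algebra.algebraMap_self_apply, HahnSeries.ofPowerSeries_C,
    HahnSeries.C_apply, HahnSeries.single_mul_single, zero_add, mul_one, nsmul_eq_mul, mul_neg,
    mul_comm]

theorem airyMatrix_map_mul_of {y : ℕ → Fin (N + 1) → LaurentSeries ℂ}
    (hy : ∀ j, y (N + 1) j = HahnSeries.single (-(r * m : ℤ)) b * y 0 j) :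
    (airyMatrix N m b).map (polyToLaurent r) * Matrix.of (fun i j : Fin (N + 1) => y i j) =
      Matrix.of fun i j : Fin (N + 1) => y (i + 1) j := by
  ext1 i j
  cases i using Fin.lastCases with
  | cast i => simp [Matrix.mul_apply, airyMatrix, apply_ite, (Fin.castSucc_lt_last i).ne]
  | last => simp [Matrix.mul_apply, airyMatrix, apply_ite, polyToLaurent_C_mul_X_pow, hy]

end AiryMatrix

theorem toLaurent_mono (r : ℕ) (a : ℂ) (k : ℚ) (hk : 0 < k) :
    (mono a k hk).toLaurent r = HahnSeries.single (-(numer r k : ℤ)) a := by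
  simp [mono, ExpFactor.toLaurent]

theorem zDeriv_toLaurent_mono {r d : ℕ} (hr : r ≠ 0) {k : ℚ} (hk : 0 < k) (hd : (r : ℚ) * k = d)
    (a : ℂ) :
    zDeriv r ((mono a k hk).toLaurent r) = HahnSeries.single ((r : ℤ) - d) (k * a) := by
  have hd' : (r : ℂ) * k = d := mod_cast congrArg (Rat.cast : ℚ → ℂ) hd
  have hr' : (r : ℂ) ≠ 0 := mod_cast hr
  rw [toLaurent_mono, numer, hd, Nat.floor_natCast, zDeriv_single, neg_add_eq_sub]
  congr 1
  push_cast
  rw [← hd']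
  field_simp

theorem ram_mono_dvd {r d : ℕ} {k : ℚ} (hk : 0 < k) (hd : (r : ℚ) * k = d) (a : ℂ) :
    ram (mono a k hk) ∣ r := by
  refine Finset.lcm_dvd fun l hl => ?_
  rw [Finset.mem_singleton.1 (Finsupp.support_single_subset hl)]
  rcases eq_or_ne r 0 with rfl | hr
  · exact dvd_zero _
  · have h := Rat.den_dvd d r
    rw [Rat.divInt_eq_div, Int.cast_natCast, Int.cast_natCast, ← hd,
      mul_div_cancel_left₀ _ (Nat.cast_ne_zero.2 hr)] at h
    exact_mod_cast h

theorem sum_range_sub_two_mul (c : ℤ) (N : ℕ) :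
    ∑ i ∈ Finset.range (N + 1), (c * N - 2 * c * i) = 0 := by
  have h (n : ℕ) : ∑ i ∈ Finset.range n, (c * N - 2 * c * i) = c * n * (N + 1 - n) := by
    induction n with
    | zero => simp
    | succ n ih => rw [Finset.sum_range_succ, ih]; push_cast; ring
  rw [h]
  push_cast
  ring

theorem hasNormalFormOver_airyMatrix {N m r : ℕ} (hr : r ≠ 0) (hNr : 2 * (N + 1) ∣ r) {k : ℚ}
    (hk : 0 < k) (hkN : k * (N + 1) = N + 1 + m) {b : ℂ} (hb : b ≠ 0) {a : Fin (N + 1) → ℂ}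
    (ha : Function.Injective a) (hab : ∀ j, (k * a j) ^ (N + 1) = b) :
    HasNormalFormOver r (airyMatrix N m b) fun j => mono (a j) k hk := by
  obtain ⟨u, rfl⟩ := hNr
  set r := 2 * (N + 1) * u
  set d := 2 * (N + 1 + m) * u with hd
  have hrd : (r : ℚ) * k = d := by push_cast [r, hd]; linear_combination 2 * (u : ℚ) * hkN
  have hd₀ : d ≠ 0 := by
    have hu : u ≠ 0 := by rintro rfl; simp [r] at hr
    positivity
  set β : Fin (N + 1) → ℂ := fun j => k * a j
  have hβ : Function.Injective β :=
    (mul_right_injective₀ (Rat.cast_ne_zero.2 hk.ne')).comp ha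
  have hβ₀ (j) : β j ≠ 0 := fun h => hb (by rw [← hab j, ← zero_pow N.succ_ne_zero, ← h])
  -- The leading power of `z` in the solutions, `z ^ (-m N / (2 (N + 1)))`, makes `Λ` vanish.
  set e : ℕ → ℤ := fun i => (u * m : ℤ) * N - 2 * (u * m) * i with he
  have hestep (i : ℕ) : e (i + 1) = e i + r - d := by push_cast [he, hd, r]; ring
  have hexp : ((N + 1 : ℕ) : ℤ) * ((r : ℤ) - d) = -(r * m) := by push_cast [hd, r]; ring
  choose P hP₀ hP hPN using fun j =>
    exists_powSeries_solution hr hd₀ N.succ_ne_zero (hβ₀ j) hestep (sum_range_sub_two_mul _ N)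
  refine ⟨Matrix.of fun i j => powSeries (e i) hd₀ (P j i), 0, fun j => ram_mono_dvd hk hrd _,
    isUnit_powSeries_of_injective (fun i => e i) hd₀ hβ fun i j => hP₀ j i, fun _ _ _ => rfl, ?_⟩
  rw [airyMatrix_map_mul_of (y := fun i j => powSeries (e i) hd₀ (P j i))
      fun j => by rw [hPN, hab, hexp],
    Matrix.map_zero _ HahnSeries.single_eq_zero, add_zero]
  ext1 i j
  rw [Matrix.mul_diagonal, zDeriv_toLaurent_mono hr hk hrd, Matrix.sub_apply, Matrix.map_apply,
    Matrix.of_apply, Matrix.of_apply, ← hP]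
  exact add_sub_cancel_left _ _

/-- The factor `e ^ (2 π i k)` by which `z ^ k` is multiplied when going once around infinity. -/
def monodromy (k : ℚ) : ℂ := Complex.exp (2 * Real.pi * Complex.I * k)

theorem isPrimitiveRoot_monodromy (k : ℚ) : IsPrimitiveRoot (monodromy k) k.den := by
  have hexp : 2 * Real.pi * Complex.I * (k : ℂ) = k.num * (2 * Real.pi * Complex.I / k.den) := by
    rw [Rat.cast_def]
    ring
  rw [monodromy, hexp, Complex.exp_int_mul]
  exact (Complex.isPrimitiveRoot_exp k.den k.den_nz).zpow_of_gcd_eq_one k.num k.reduced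

theorem circ_eq_circ_iff {q q' : ExpFactor} :
    circ q = circ q' ↔ ∃ n : ℤ, ∀ k : Exponent, q' k = monodromy k ^ n * q k := by
  have hpow (n : ℤ) (k : ℚ) :
      Complex.exp (2 * Real.pi * Complex.I * n * k) = monodromy k ^ n := by
    rw [monodromy, ← Complex.exp_int_mul]
    ring_nf
  simp only [← hpow]
  exact Quotient.eq

theorem support_eq_of_circ_eq {q q' : ExpFactor} (h : circ q = circ q') :
    q.support = q'.support :=
  GaloisConj.support_eq (Quotient.exact h.symm)

section Monomial

variable {a : ℂ} {k : ℚ} {hk : 0 < k}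

theorem circ_mono_eq_circ_iff {p : ExpFactor} :
    circ (mono a k hk) = circ p ↔ ∃ n : ℤ, mono (monodromy k ^ n * a) k hk = p := by
  rw [circ_eq_circ_iff]
  refine exists_congr fun n => ?_
  rw [eq_comm (b := p), DFunLike.ext_iff]
  refine forall_congr' fun l => ?_
  rcases eq_or_ne l ⟨k, hk⟩ with rfl | hl
  · simp [mono]
  · simp [mono, Finsupp.single_eq_of_ne hl]

theorem card_fiber_mono_eq_count [DecidableEq StokesCircle] {n : ℕ} (hn : k.den = n) (ha : a ≠ 0)
    (p : ExpFactor) :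
    Nat.card {j : Fin n // mono (monodromy k ^ (j : ℕ) * a) k hk = p} =
      Multiset.count (circ p) {circ (mono a k hk)} := by
  have hζ := hn ▸ isPrimitiveRoot_monodromy k
  have hn₀ : (n : ℤ) ≠ 0 := mod_cast hn ▸ k.den_nz
  rw [Multiset.count_singleton]
  split_ifs with h
  · obtain ⟨i, rfl⟩ := circ_mono_eq_circ_iff.1 h.symm
    have : NeZero n := ⟨mod_cast hn₀⟩
    obtain ⟨j, hj, hji⟩ := hζ.eq_pow_of_pow_eq_one (ξ := monodromy k ^ i) (by
      rw [← zpow_natCast, zpow_comm, zpow_natCast, hζ.pow_eq_one, one_zpow])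
    refine Nat.card_eq_one_iff_exists.2 ⟨⟨⟨j, hj⟩, by rw [hji]⟩, fun l => Subtype.ext (Fin.ext ?_)⟩
    refine hζ.pow_inj l.1.2 hj (mul_right_cancel₀ ha ?_)
    rw [hji]
    exact Finsupp.single_injective _ l.2
  · refine Nat.card_eq_zero.2 (Or.inl ⟨fun j => h ?_⟩)
    exact (circ_mono_eq_circ_iff.2 ⟨(j : ℕ), by rw [zpow_natCast]; exact j.2⟩).symm

end Monomial

theorem hasIrregularClassOver_airyMatrix {N m r : ℕ} (hr : r ≠ 0) (hNr : 2 * (N + 1) ∣ r) {k : ℚ}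
    (hk : 0 < k) (hden : k.den = N + 1) (hkN : k * (N + 1) = N + 1 + m) {a : ℂ} (ha : a ≠ 0) :
    HasIrregularClassOver r (airyMatrix N m ((k * a) ^ (N + 1))) {circ (mono a k hk)} := by
  classical
  have hζ := hden ▸ isPrimitiveRoot_monodromy k
  refine ⟨fun j => mono (monodromy k ^ (j : ℕ) * a) k hk,
    hasNormalFormOver_airyMatrix hr hNr hk hkN
      (pow_ne_zero (N + 1) (mul_ne_zero (Rat.cast_ne_zero.2 hk.ne') ha))
      (fun i j h => Fin.ext (hζ.pow_inj i.2 j.2 (mul_right_cancel₀ ha h))) fun j => ?_,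
    card_fiber_mono_eq_count hden ha⟩
  rw [mul_left_comm, mul_pow, pow_right_comm, hζ.pow_eq_one, one_pow, one_mul]

theorem exists_exampleMatrix_eq_reindex (a b c : ℂ) :
    ∃ e : (Fin 1 ⊕ Fin 3) ⊕ Fin 2 ≃ Fin 6, exampleMatrix a b c =
      (Matrix.fromBlocks (Matrix.fromBlocks (airyMatrix 0 2 a) 0 0 (airyMatrix 2 1 b)) 0 0
        (airyMatrix 1 1 c)).reindex e e := by
  refine ⟨⟨Sum.elim (Sum.elim ![0] ![1, 2, 3]) ![4, 5],
    ![.inl (.inl 0), .inl (.inr 0), .inl (.inr 1), .inl (.inr 2), .inr 0, .inr 1],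
    by decide, by decide⟩, ?_⟩
  ext1 i j
  fin_cases i <;> fin_cases j <;> simp [exampleMatrix, airyMatrix]

theorem hasIrregularClass_exampleMatrix {a b c : ℂ} (ha : a ≠ 0) (hb : b ≠ 0) (hc : c ≠ 0) :
    (AlgConnection.ofMatrix
      (exampleMatrix (3 * a) ((4 / 3 * b) ^ 3) ((3 / 2 * c) ^ 2))).HasIrregularClass
      {circ (mono a 3 (by norm_num)), circ (mono b (4 / 3) (by norm_num)),
        circ (mono c (3 / 2) (by norm_num))} := by
  have h₁ := hasIrregularClassOver_airyMatrix (N := 0) (m := 2) (r := 12) (k := 3) (by norm_num)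
    (by norm_num) (by norm_num) (by norm_num) (by norm_num) ha
  have h₂ := hasIrregularClassOver_airyMatrix (N := 2) (m := 1) (r := 12) (k := 4 / 3)
    (by norm_num) (by norm_num) (by norm_num) (by norm_num) (by norm_num) hb
  have h₃ := hasIrregularClassOver_airyMatrix (N := 1) (m := 1) (r := 12) (k := 3 / 2)
    (by norm_num) (by norm_num) (by norm_num) (by norm_num) (by norm_num) hc
  obtain ⟨e, he⟩ := exists_exampleMatrix_eq_reindex (3 * a) ((4 / 3 * b) ^ 3) ((3 / 2 * c) ^ 2)
  rw [he]
  have h := (((h₁.fromBlocks h₂).fromBlocks h₃).reindex e).hasIrregularClass (by norm_num)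
  push_cast [pow_one] at h
  exact h

section Slope

variable {q q' : ExpFactor} {c : ℚ}

theorem slope_le_iff (hc : 0 ≤ c) : slope q ≤ c ↔ ∀ k ∈ q.support, (k : ℚ) ≤ c := by
  lift c to ℚ≥0 using hc
  simp only [slope, NNRat.cast_le, Finset.sup_le_iff, Rat.toNNRat_le_iff_le_coe]

theorem slope_lt_iff (hc : 0 < c) : slope q < c ↔ ∀ k ∈ q.support, (k : ℚ) < c := by
  lift c to ℚ≥0 using hc.le
  rw [slope, NNRat.cast_lt, Finset.sup_lt_iff (by exact_mod_cast hc)]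
  exact forall₂_congr fun k _ => Rat.toNNRat_lt_iff_lt_coe k.2.le

theorem slope_nonneg (q : ExpFactor) : 0 ≤ slope q := NNRat.cast_nonneg _

theorem le_slope {k : Exponent} (hk : k ∈ q.support) : (k : ℚ) ≤ slope q :=
  (slope_le_iff (slope_nonneg q)).1 le_rfl k hk

theorem slope_sub_le (q q' : ExpFactor) : slope (q - q') ≤ max (slope q) (slope q') := by
  refine (slope_le_iff (le_max_of_le_left (slope_nonneg q))).2 fun k hk => ?_
  rcases Finset.mem_union.1 (Finsupp.support_sub hk) with hk | hk
  exacts [le_max_of_le_left (le_slope hk), le_max_of_le_right (le_slope hk)]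

theorem slope_mono {a : ℂ} {k : ℚ} {hk : 0 < k} (ha : a ≠ 0) : slope (mono a k hk) = k := by
  rw [slope, mono, Finsupp.support_single _ ha, Finset.sup_singleton, Rat.coe_toNNRat _ hk.le]

theorem exists_slope_eq_div_ram (q : ExpFactor) : ∃ m : ℕ, slope q = m / ram q := by
  rcases q.support.eq_empty_or_nonempty with hq | hq
  · exact ⟨0, by simp [slope, hq]⟩
  · obtain ⟨k, hk, hsup⟩ := Finset.exists_mem_eq_sup q.support hq fun k => (k : ℚ).toNNRat
    obtain ⟨m, hm⟩ := (ram_isLeast q).1.2 k hk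
    exact ⟨m, by rw [slope, hsup, Rat.coe_toNNRat _ k.2.le, hm]⟩

theorem ram_pos (q : ExpFactor) : 0 < ram q := (ram_isLeast q).1.1

theorem natCast_numer_ram_slope (q : ExpFactor) :
    (numer (ram q) (slope q) : ℚ) = ram q * slope q := by
  obtain ⟨m, hm⟩ := exists_slope_eq_div_ram q
  have hr : (ram q : ℚ) ≠ 0 := mod_cast (ram_pos q).ne'
  rw [numer, hm, mul_div_cancel₀ _ hr, Nat.floor_natCast]

theorem ram_mono {a : ℂ} {k : ℚ} {hk : 0 < k} (ha : a ≠ 0) : ram (mono a k hk) = k.den := by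
  rw [ram, mono, Finsupp.support_single _ ha, Finset.lcm_singleton, normalize_eq]

end Slope

section Cutoff

variable {q q' : ExpFactor} {c : ℚ}

theorem trunc_eq_trunc_iff (hc : 0 < c) : trunc c q = trunc c q' ↔ slope (q - q') < c := by
  rw [slope_lt_iff hc, DFunLike.ext_iff]
  refine forall_congr' fun k => ?_
  rw [Finsupp.mem_support_iff, Finsupp.sub_apply, sub_ne_zero, not_imp_comm, not_lt]
  by_cases hk : c ≤ k <;> simp [trunc, hk]

theorem cutoff_pos_and_circ_trunc_eq (q q' : ExpFactor) :
    0 < cutoff q q' ∧ circ (trunc (cutoff q q') q) = circ (trunc (cutoff q q') q') := by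
  have hL : (0 : ℚ) < Nat.lcm (ram q) (ram q') :=
    mod_cast Nat.lcm_pos (ram_pos q) (ram_pos q')
  suffices hne : {m : ℕ | 0 < m ∧ circ (trunc (m / Nat.lcm (ram q) (ram q')) q) =
      circ (trunc (m / Nat.lcm (ram q) (ram q')) q')}.Nonempty from
    ⟨div_pos (mod_cast (Nat.sInf_mem hne).1) hL, (Nat.sInf_mem hne).2⟩
  obtain ⟨m, hm⟩ := exists_nat_gt (slope (q - q') * Nat.lcm (ram q) (ram q'))
  have hm₀ : (0 : ℚ) < m := (mul_nonneg (slope_nonneg _) hL.le).trans_lt hm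
  exact ⟨m, mod_cast hm₀,
    congrArg circ ((trunc_eq_trunc_iff (div_pos hm₀ hL)).2 ((lt_div_iff₀ hL).2 hm))⟩

theorem commonPart_eq_zero_of_disjoint (h : Disjoint q.support q'.support) :
    commonPart q q' = 0 := by
  have hsupp := support_eq_of_circ_eq (cutoff_pos_and_circ_trunc_eq q q').2
  rw [commonPart, ← Finsupp.support_eq_empty, ← Finset.bot_eq_empty, ← disjoint_self]
  nth_rw 2 [hsupp]
  exact h.mono (Finset.filter_subset _ _) (Finset.filter_subset _ _)

theorem diffPart_eq_self_of_disjoint (h : Disjoint q.support q'.support) : diffPart q q' = q := by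
  rw [diffPart, commonPart_eq_zero_of_disjoint h, sub_zero]

end Cutoff

section EdgeMult

variable {q q' : ExpFactor}

theorem gcdOf_empty (r : ℕ) : gcdOf r ∅ = r := by simp [gcdOf]

theorem edgeFormula_of_disjoint (h : Disjoint q.support q'.support) :
    (edgeFormula q q' : ℚ) = ram q * ram q' * (slope q - 1) := by
  simp only [edgeFormula, commonPart_eq_zero_of_disjoint h, diffPart_eq_self_of_disjoint h,
    Finsupp.support_zero, levelSum, Finset.sum_empty, gcdOf_empty]
  push_cast [natCast_numer_ram_slope]
  ring

theorem edgeMult_of_disjoint (h : Disjoint q.support q'.support) :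
    (edgeMult q q' : ℚ) = ram q * ram q' * (max (slope q) (slope q') - 1) := by
  rw [edgeMult, diffPart_eq_self_of_disjoint h, diffPart_eq_self_of_disjoint h.symm]
  split_ifs with hs
  · rw [edgeFormula_of_disjoint h, max_eq_left hs]
  · rw [edgeFormula_of_disjoint h.symm, max_eq_right (not_le.1 hs).le, mul_comm (ram q' : ℚ)]

end EdgeMult

section Monomial

variable {a b : ℂ} {k l : ℚ} {hk : 0 < k} {hl : 0 < l}

theorem disjoint_support_mono (hkl : k ≠ l) :
    Disjoint (mono a k hk).support (mono b l hl).support :=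
  Finset.disjoint_of_subset_left Finsupp.support_single_subset <|
    Finset.disjoint_of_subset_right Finsupp.support_single_subset <|
      Finset.disjoint_singleton.2 fun h => hkl (congrArg Subtype.val h)

theorem circ_mono_ne (ha : a ≠ 0) (hkl : k ≠ l) :
    circ (mono a k hk) ≠ circ (mono b l hl) := by
  intro h
  have hdisj := disjoint_support_mono (a := a) (b := b) (hk := hk) (hl := hl) hkl
  rw [← support_eq_of_circ_eq h, disjoint_self, mono, Finsupp.support_single _ ha] at hdisj
  exact Finset.singleton_ne_empty _ hdisj

theorem mult_mono_of_ne (ha : a ≠ 0) (hb : b ≠ 0) (hkl : k ≠ l) :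
    ((circ (mono a k hk)).mult (circ (mono b l hl)) : ℚ) = k.den * l.den * (max k l - 1) := by
  rw [StokesCircle.mult, if_neg (circ_mono_ne ha hkl)]
  exact (edgeMult_of_disjoint (disjoint_support_mono hkl)).trans
    (by rw [ram_mono ha, ram_mono hb, slope_mono ha, slope_mono hb])

theorem mult_mono_self (ha : a ≠ 0) :
    (circ (mono a k hk)).mult (circ (mono a k hk)) =
      ((k.den : ℤ) - 1) * (k.num - k.den - 1) := by
  have hnum : (numer k.den k : ℤ) = k.num := by
    have h := natCast_numer_ram_slope (mono a k hk)
    rw [ram_mono ha, slope_mono ha, Rat.den_mul_eq_num] at h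
    exact_mod_cast h
  have hgcd : gcdOf k.den {⟨k, hk⟩} = 1 := by
    rw [gcdOf, Finset.gcd_singleton, normalize_eq, ← Int.natAbs_natCast (numer k.den k), hnum]
    exact k.reduced.symm
  have hloop : loopMult (mono a k hk) = numer k.den k * ((k.den : ℤ) - 1) - k.den ^ 2 + 1 := by
    rw [loopMult, ram_mono ha, mono, Finsupp.support_single _ ha, levelSum, Finset.sum_singleton]
    simp [Finset.filter_singleton, gcdOf_empty, hgcd]
  rw [StokesCircle.mult, if_pos rfl]
  refine hloop.trans ?_
  rw [hnum]
  ring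

end Monomial
section Example

theorem Diagram.isCoreDiagramOf_of_injective {Γ : Diagram} {Θ : IrregularClass}
    {f : Γ.N → StokesCircle} (hf : Function.Injective f) (hΘ : ∀ I, I ∈ Θ ↔ I ∈ Set.range f)
    (hB : ∀ i j, Γ.B i j = (f i).mult (f j)) : Γ.IsCoreDiagramOf Θ :=
  ⟨(Equiv.ofInjective f hf).trans (Equiv.subtypeEquivRight fun I => (hΘ I).symm), hB⟩

/-- The slopes of the three Stokes circles of the example, in the order of the vertices of
`triangle346`. -/
def exampleSlope : Fin 3 → ℚ := ![3, 4 / 3, 3 / 2]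

theorem exampleSlope_pos (i : Fin 3) : 0 < exampleSlope i := by
  fin_cases i <;> norm_num [exampleSlope]

theorem exampleSlope_injective : Function.Injective exampleSlope := by
  intro i j
  fin_cases i <;> fin_cases j <;> norm_num [exampleSlope]

/-- The Stokes circles of `exampleMatrix`, with arbitrary leading coefficients: the vertices of its
core diagram, in the order of `triangle346`. -/
def exampleCircle (a : Fin 3 → ℂ) (i : Fin 3) : StokesCircle :=
  circ (mono (a i) (exampleSlope i) (exampleSlope_pos i))

variable {a : Fin 3 → ℂ}

theorem exampleCircle_injective (ha : ∀ i, a i ≠ 0) : Function.Injective (exampleCircle a) :=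
  fun i _ h => exampleSlope_injective (not_imp_not.1 (circ_mono_ne (ha i)) h)

theorem mult_exampleCircle (ha : ∀ i, a i ≠ 0) (i j : Fin 3) :
    (exampleCircle a i).mult (exampleCircle a j) = !![0, 6, 4; 6, 0, 3; 4, 3, 0] i j := by
  by_cases hij : i = j
  · subst hij
    rw [exampleCircle, mult_mono_self (ha i)]
    fin_cases i <;> norm_num [exampleSlope]
  · have h := mult_mono_of_ne (hk := exampleSlope_pos i) (hl := exampleSlope_pos j) (ha i) (ha j)
      (exampleSlope_injective.ne hij)
    rw [← Int.cast_inj (α := ℚ)]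
    refine h.trans ?_
    fin_cases i <;> fin_cases j <;> first
      | exact absurd rfl hij
      | norm_num [exampleSlope]

theorem range_exampleCircle {a b c : ℂ} :
    Set.range (exampleCircle ![a, b, c]) =
      {circ (mono a 3 (by norm_num)), circ (mono b (4 / 3) (by norm_num)),
        circ (mono c (3 / 2) (by norm_num))} := by
  ext I
  refine (Fin.exists_fin_succ.trans (or_congr_right Fin.exists_fin_two)).trans ?_
  simp only [Set.mem_insert_iff, Set.mem_singleton_iff, eq_comm (a := I)]
  rfl

theorem isCoreDiagramOf_triangle346 {a b c : ℂ} (ha : a ≠ 0) (hb : b ≠ 0) (hc : c ≠ 0) :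
    triangle346.IsCoreDiagramOf
      {circ (mono a 3 (by norm_num)), circ (mono b (4 / 3) (by norm_num)),
        circ (mono c (3 / 2) (by norm_num))} := by
  have h : ∀ i, ![a, b, c] i ≠ 0 := by simp [Fin.forall_fin_succ, ha, hb, hc]
  refine Diagram.isCoreDiagramOf_of_injective (exampleCircle_injective h) (fun I => ?_)
    fun i j => (mult_exampleCircle h i j).symm
  exact Iff.trans (by simp) (Set.ext_iff.1 range_exampleCircle I).symm

end Example

section Untwisted

variable {q q' : ExpFactor}

theorem circ_eq_circ_iff_of_ram_eq_one (hq : ram q = 1) : circ q = circ q' ↔ q = q' := by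
  refine ⟨fun h => ?_, congrArg circ⟩
  obtain ⟨n, hn⟩ := circ_eq_circ_iff.1 h
  ext k
  rw [hn k]
  by_cases hk : q k = 0
  · rw [hk, mul_zero]
  · have hden : (k : ℚ).den ∣ 1 := hq ▸ Finset.dvd_lcm (Finsupp.mem_support_iff.2 hk)
    have hone : monodromy k = 1 := by
      simpa only [pow_one] using ((isPrimitiveRoot_monodromy k).pow_eq_one_iff_dvd 1).2 hden
    rw [hone, one_zpow, one_mul]

theorem ram_trunc_dvd (c : ℚ) (q : ExpFactor) : ram (trunc c q) ∣ ram q :=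
  Finset.lcm_mono (Finset.filter_subset _ _)

theorem slope_sub_comm (q q' : ExpFactor) : slope (q - q') = slope (q' - q) := by
  rw [← neg_sub, slope, Finsupp.support_neg, slope]

theorem cutoff_of_ram_eq_one (hq : ram q = 1) (hq' : ram q' = 1) :
    cutoff q q' = ⌊slope (q - q')⌋₊ + 1 := by
  have hset : {m : ℕ | 0 < m ∧ circ (trunc m q) = circ (trunc m q')} =
      Set.Ici (⌊slope (q - q')⌋₊ + 1) := by
    ext m
    rw [Set.mem_ofPred_eq, Set.mem_Ici, Nat.add_one_le_iff, Nat.floor_lt (slope_nonneg _),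
      circ_eq_circ_iff_of_ram_eq_one (Nat.dvd_one.1 (hq ▸ ram_trunc_dvd _ q))]
    refine ⟨fun h => (trunc_eq_trunc_iff (mod_cast h.1)).1 h.2, fun h => ?_⟩
    have hm : (0 : ℚ) < m := (slope_nonneg _).trans_lt h
    exact ⟨mod_cast hm, (trunc_eq_trunc_iff hm).2 h⟩
  simp only [cutoff, hq, hq', Nat.lcm_self, Nat.cast_one, div_one, hset, csInf_Ici]
  exact Nat.cast_succ _

theorem slope_diffPart_lt_cutoff (q q' : ExpFactor) : slope (diffPart q q') < cutoff q q' := by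
  rw [slope_lt_iff (cutoff_pos_and_circ_trunc_eq q q').1]
  intro k hk
  by_contra! hc
  simp [diffPart, commonPart, trunc, hc] at hk

theorem commonPart_comm_of_ram_eq_one (hq : ram q = 1) (hq' : ram q' = 1) :
    commonPart q q' = commonPart q' q := by
  rw [commonPart, commonPart, cutoff_of_ram_eq_one hq' hq, slope_sub_comm,
    ← cutoff_of_ram_eq_one hq hq',
    ← circ_eq_circ_iff_of_ram_eq_one (Nat.dvd_one.1 (hq ▸ ram_trunc_dvd _ q))]
  exact (cutoff_pos_and_circ_trunc_eq q q').2

theorem floor_max_slope_diffPart (hq : ram q = 1) (hq' : ram q' = 1) :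
    ⌊max (slope (diffPart q q')) (slope (diffPart q' q))⌋₊ = ⌊slope (q - q')⌋₊ := by
  have hsub : diffPart q q' - diffPart q' q = q - q' := by
    rw [diffPart, diffPart, commonPart_comm_of_ram_eq_one hq hq', sub_sub_sub_cancel_right]
  refine le_antisymm (Nat.lt_succ_iff.1 ?_) (Nat.floor_le_floor (hsub ▸ slope_sub_le _ _))
  rw [Nat.floor_lt (le_max_of_le_left (slope_nonneg _)), max_lt_iff]
  have h := slope_diffPart_lt_cutoff q q'
  have h' := slope_diffPart_lt_cutoff q' q
  rw [cutoff_of_ram_eq_one hq hq'] at h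
  rw [cutoff_of_ram_eq_one hq' hq, slope_sub_comm] at h'
  exact ⟨mod_cast h, mod_cast h'⟩

theorem edgeFormula_of_ram_eq_one (hq : ram q = 1) (hq' : ram q' = 1) :
    edgeFormula q q' = ⌊slope (diffPart q q')⌋₊ - 1 := by
  simp [edgeFormula, levelSum, gcdOf, numer, hq, hq']

theorem edgeMult_of_ram_eq_one (hq : ram q = 1) (hq' : ram q' = 1) :
    edgeMult q q' = ⌊slope (q - q')⌋₊ - 1 := by
  rw [← floor_max_slope_diffPart hq hq', edgeMult, edgeFormula_of_ram_eq_one hq hq',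
    edgeFormula_of_ram_eq_one hq' hq]
  split_ifs with h
  · rw [max_eq_left h]
  · rw [max_eq_right (not_le.1 h).le]

theorem edgeMult_le_max_of_ram_eq_one {s : ExpFactor} (hq : ram q = 1) (hq' : ram q' = 1)
    (hs : ram s = 1) : edgeMult q q' ≤ max (edgeMult q s) (edgeMult q' s) := by
  rw [edgeMult_of_ram_eq_one hq hq', edgeMult_of_ram_eq_one hq hs, edgeMult_of_ram_eq_one hq' hs]
  have h : slope (q - q') ≤ max (slope (q - s)) (slope (q' - s)) := by
    rw [← sub_sub_sub_cancel_right q q' s]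
    exact slope_sub_le _ _
  rcases le_max_iff.1 h with h | h
  · exact le_max_of_le_left (sub_le_sub_right (mod_cast Nat.floor_le_floor h) 1)
  · exact le_max_of_le_right (sub_le_sub_right (mod_cast Nat.floor_le_floor h) 1)

theorem StokesCircle.mult_le_max_of_ram_eq_one {I J K : StokesCircle} (hI : I.ram = 1)
    (hJ : J.ram = 1) (hK : K.ram = 1) (hIJ : I ≠ J) (hIK : I ≠ K) (hJK : J ≠ K) :
    I.mult J ≤ max (I.mult K) (J.mult K) := by
  rw [mult, mult, mult, if_neg hIJ, if_neg hIK, if_neg hJK]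
  induction I, J using Quotient.inductionOn₂
  induction K using Quotient.inductionOn
  exact edgeMult_le_max_of_ram_eq_one hI hJ hK

theorem Diagram.IsFissionGraph.isUltrametric {Γ : Diagram} (h : Γ.IsFissionGraph) :
    Γ.IsUltrametric := by
  obtain ⟨_, Θ, -, hΘ, e, he⟩ := h
  intro i j k hij hik hjk hij_le hik_le
  have hne : ∀ {a b : Γ.N}, a ≠ b → (e a : StokesCircle) ≠ e b :=
    (Subtype.val_injective.comp e.injective).ne
  have hmax := StokesCircle.mult_le_max_of_ram_eq_one (hΘ _ (e j).2) (hΘ _ (e k).2)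
    (hΘ _ (e i).2) (hne hjk) (hne hij.symm) (hne hik.symm)
  rw [← he, ← he, ← he, Γ.symm j i, Γ.symm k i, max_eq_right hij_le] at hmax
  exact le_antisymm hik_le hmax

end Untwisted

section Triangle

theorem not_isUltrametric_triangle346 : ¬ triangle346.IsUltrametric := by
  intro h
  have h46 : (4 : ℤ) = 6 := h (2 : Fin 3) (1 : Fin 3) (0 : Fin 3)
    (by decide : (2 : Fin 3) ≠ 1) (by decide : (2 : Fin 3) ≠ 0) (by decide : (1 : Fin 3) ≠ 0)
    (by decide : (3 : ℤ) ≤ 4) (by decide : (4 : ℤ) ≤ 6)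
  exact absurd h46 (by decide)

theorem isGraph_triangle346 : triangle346.IsGraph :=
  have hB : (∀ i j, 0 ≤ (!![0, 6, 4; 6, 0, 3; 4, 3, 0] : Matrix (Fin 3) (Fin 3) ℤ) i j) ∧
      ∀ i, (!![0, 6, 4; 6, 0, 3; 4, 3, 0] : Matrix (Fin 3) (Fin 3) ℤ) i i = 0 := by
    simp [Fin.forall_fin_succ]
  hB

end Triangle

end NAHodge

end

theorem proposition3p3 :
    -- there exist nonabelian Hodge graphs that are not fission graphs
    (∃ Γ : Diagram, Γ.IsNonabelianHodgeGraph ∧ ¬ Γ.IsFissionGraph) ∧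
    -- explicit connections on the affine line and their irregular classes
    (AlgConnection.ofMatrix (exampleMatrix 1 1 1)).HasIrregularClass
      {circ (mono (1 / 3) 3 (by norm_num)), circ (mono (3 / 4) (4 / 3) (by norm_num)),
        circ (mono (2 / 3) (3 / 2) (by norm_num))} ∧
    (AlgConnection.ofMatrix (exampleMatrix 3 (64 / 27) (9 / 4))).HasIrregularClass
      {circ (mono 1 3 (by norm_num)), circ (mono 1 (4 / 3) (by norm_num)),
        circ (mono 1 (3 / 2) (by norm_num))} ∧
    -- the multiplicities for `I = ⟨z ^ 3⟩`, `J = ⟨z ^ (4/3)⟩`, `K = ⟨z ^ (3/2)⟩`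
    (∀ I J K : StokesCircle, I = circ (mono 1 3 (by norm_num)) →
      J = circ (mono 1 (4 / 3) (by norm_num)) → K = circ (mono 1 (3 / 2) (by norm_num)) →
      I ≠ J ∧ I ≠ K ∧ J ≠ K ∧ I.mult I = 0 ∧ J.mult J = 0 ∧ K.mult K = 0 ∧
        I.mult J = 6 ∧ J.mult K = 3 ∧ K.mult I = 4) ∧
    -- the core diagram of both irregular classes is the triangle
    triangle346.IsCoreDiagramOf
      {circ (mono (1 / 3) 3 (by norm_num)), circ (mono (3 / 4) (4 / 3) (by norm_num)),
        circ (mono (2 / 3) (3 / 2) (by norm_num))} ∧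
    triangle346.IsCoreDiagramOf
      {circ (mono 1 3 (by norm_num)), circ (mono 1 (4 / 3) (by norm_num)),
        circ (mono 1 (3 / 2) (by norm_num))} ∧
    -- the triangle violates the ultrametric condition, is a nonabelian Hodge graph, and is not a
    -- fission graph
    ¬ triangle346.IsUltrametric ∧
    triangle346.IsNonabelianHodgeGraph ∧ ¬ triangle346.IsFissionGraph := by
  have h₁ : (AlgConnection.ofMatrix (exampleMatrix 1 1 1)).HasIrregularClass
      {circ (mono (1 / 3) 3 (by norm_num)), circ (mono (3 / 4) (4 / 3) (by norm_num)),
        circ (mono (2 / 3) (3 / 2) (by norm_num))} := by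
    convert hasIrregularClass_exampleMatrix (a := 1 / 3) (b := 3 / 4) (c := 2 / 3) (by norm_num)
      (by norm_num) (by norm_num) <;> norm_num
  have h₂ : (AlgConnection.ofMatrix (exampleMatrix 3 (64 / 27) (9 / 4))).HasIrregularClass
      {circ (mono 1 3 (by norm_num)), circ (mono 1 (4 / 3) (by norm_num)),
        circ (mono 1 (3 / 2) (by norm_num))} := by
    convert hasIrregularClass_exampleMatrix one_ne_zero one_ne_zero one_ne_zero <;> norm_num
  have hcore := isCoreDiagramOf_triangle346 (one_ne_zero (α := ℂ)) (one_ne_zero (α := ℂ))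
    (one_ne_zero (α := ℂ))
  have hgraph : triangle346.IsNonabelianHodgeGraph := ⟨⟨_, _, h₂, hcore⟩, isGraph_triangle346⟩
  have hfission : ¬ triangle346.IsFissionGraph := fun h =>
    not_isUltrametric_triangle346 h.isUltrametric
  refine ⟨⟨_, hgraph, hfission⟩, h₁, h₂, ?_, isCoreDiagramOf_triangle346 (by norm_num)
    (by norm_num) (by norm_num), hcore, not_isUltrametric_triangle346, hgraph, hfission⟩
  rintro _ _ _ rfl rfl rfl
  have hinj := exampleCircle_injective (a := fun _ => 1) fun _ => one_ne_zero
  have hmult := mult_exampleCircle (a := fun _ => 1) fun _ => one_ne_zero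
  exact ⟨hinj.ne (a₁ := 0) (a₂ := 1) (by decide), hinj.ne (a₁ := 0) (a₂ := 2) (by decide),
    hinj.ne (a₁ := 1) (a₂ := 2) (by decide), hmult 0 0, hmult 1 1, hmult 2 2, hmult 0 1,
    hmult 1 2, hmult 2 0⟩
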